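/- Let $dm$ denote Lebesgue measure on $\mathbb{C}$ and let $\mathcal{F}^2$ be the Fock space, i.e. the closed subspace of $L^2(\mathbb{C}, e^{-|z|^2}dm(z))$ consisting of all entire functions $f$ with $\int_{\mathbb{C}} |f(z)|^2 e^{-|z|^2}\,dm(z) < \infty$. Let $P$ be the orthogonal projection of $L^2(\mathbb{C}, e^{-|z|^2}dm(z))$ onto $\mathcal{F}^2$, and for a bounded compactly supported function $V:\mathbb{C}\to\mathbb{R}$ let $T_V:\mathcal{F}^2\to\mathcal{F}^2$, $T_V f = P(Vf)$, be the Bargmann–Toeplitz operator with symbol $V$. Theorem. Let $V:\mathbb{C}\to\mathbb{R}$ be continuous with compact support, let $V_-=(|V|-V)/2$, and suppose that $\operatorname{supp} V$ is connected. Suppose that there exist a smooth simple closed curve $\Gamma\subset\operatorname{supp}V$ (it suffices that $\Gamma$ has a closed parametrization of class $C^1$ with nowhere vanishing derivative, injective on a period) and a number $\delta>0$ such that $V(z)\ge\delta$ for all $z\in\Gamma$ and $\operatorname{supp}V_-$ lies inside $\Gamma$, i.e. in the bounded part of $\mathbb{C}\setminus\Gamma$. Then $T_V$ has only finitely many negative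 eigenvalues, counted with multiplicities: the set of negative eigenvalues of $T_V$ is finite and each of them has finite multiplicity. -/

import Mathlib

noncomputable section

open MeasureTheory Set Filter Topology
open scoped ENNReal

namespace BargmannToeplitz

/-- The measure `e^{-|z|²} dm(z)` on the complex plane, where `m` is Lebesgue measure. -/
def fockMeasure : Measure ℂ :=
  volume.withDensity (fun z : ℂ => ENNReal.ofReal (Real.exp (-‖z‖ ^ 2)))

/-- The Fock space: the (classes of) entire functions in `L²(ℂ, e^{-|z|²} dm(z))`, with the
inner product and norm of that `L²` space. -/
def fockSpace : Submodule ℂ (Lp ℂ 2 fockMeasure) where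
  carrier := {f | ∃ g : ℂ → ℂ, Differentiable ℂ g ∧ f =ᵐ[fockMeasure] g}
  add_mem' := by
    rintro a b ⟨g, hg, hag⟩ ⟨h, hh, hbh⟩
    exact ⟨g + h, hg.add hh, (Lp.coeFn_add a b).trans (hag.add hbh)⟩
  zero_mem' := ⟨0, differentiable_const 0, Lp.coeFn_zero ℂ 2 fockMeasure⟩
  smul_mem' := by
    rintro c a ⟨g, hg, hag⟩
    exact ⟨c • g, hg.const_smul c, (Lp.coeFn_smul c a).trans (hag.const_smul c)⟩

/-! The Fock space is closed, so that the orthogonal projection onto it exists. -/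

lemma pi_mul_enorm_le {g : ℂ → ℂ} (hg : Differentiable ℂ g) (z : ℂ) :
    ENNReal.ofReal Real.pi * ‖g z‖ₑ ≤ ∫⁻ w in Metric.ball z 1, ‖g w‖ₑ := by
  have hcirc : ∀ r : ℝ, ENNReal.ofReal (2 * Real.pi) * ‖g z‖ₑ ≤
      ∫⁻ θ in Ioo (-Real.pi) Real.pi, ‖g (circleMap z r θ)‖ₑ := by
    intro r
    have h1 : ∫ θ in Ioo (-Real.pi) Real.pi, g (circleMap z r θ) = (2 * Real.pi : ℝ) • g z := by
      have hav : Real.circleAverage g z r = g z := hg.diffContOnCl.circleAverage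
      rw [Real.circleAverage_def] at hav
      have hper : Function.Periodic (fun θ => g (circleMap z r θ)) (2 * Real.pi) := fun θ => by
        simp only [periodic_circleMap z r θ]
      have h2 := hper.intervalIntegral_add_eq (-Real.pi) 0
      have h3 : -Real.pi + 2 * Real.pi = Real.pi := by ring
      rw [h3, zero_add] at h2
      rw [← integral_Ioc_eq_integral_Ioo,
        ← intervalIntegral.integral_of_le (by linarith [Real.pi_pos]), h2]
      rw [← hav, smul_smul, mul_inv_cancel₀ (by positivity), one_smul]
    have h4 := enorm_integral_le_lintegral_enorm (μ := volume.restrict (Ioo (-Real.pi) Real.pi))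
      (fun θ => g (circleMap z r θ))
    rw [h1, enorm_smul] at h4
    rwa [Real.enorm_eq_ofReal (by positivity)] at h4
  have hcont : Continuous g := hg.continuous
  have hmeas : Measurable fun w : ℂ =>
      (Metric.ball (0 : ℂ) 1).indicator (fun w => ‖g (z + w)‖ₑ) w :=
    Measurable.indicator
      (hcont.comp (continuous_const.add continuous_id)).measurable.enorm measurableSet_ball
  have htr : ∫⁻ w in Metric.ball z 1, ‖g w‖ₑ =
      ∫⁻ w, (Metric.ball (0 : ℂ) 1).indicator (fun w => ‖g (z + w)‖ₑ) w := by
    rw [← lintegral_indicator measurableSet_ball,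
      ← lintegral_add_left_eq_self (μ := (volume : Measure ℂ)) _ z]
    congr 1
    funext w
    by_cases hw : w ∈ Metric.ball (0 : ℂ) 1
    · rw [indicator_of_mem hw, indicator_of_mem (by simpa using hw)]
    · rw [indicator_of_notMem hw, indicator_of_notMem (by simpa using hw)]
  rw [htr, ← Complex.lintegral_comp_polarCoord_symm]
  have hmeas2 : Measurable fun p : ℝ × ℝ => ENNReal.ofReal p.1 *
      (Metric.ball (0 : ℂ) 1).indicator (fun w => ‖g (z + w)‖ₑ) (Complex.polarCoord.symm p) := by
    refine Measurable.mul (by fun_prop) (hmeas.comp ?_)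
    have : (Complex.polarCoord.symm : ℝ × ℝ → ℂ) =
        fun p : ℝ × ℝ => (p.1 : ℂ) * (Real.cos p.2 + Real.sin p.2 * Complex.I) := by
      funext p; exact Complex.polarCoord_symm_apply p
    rw [this]
    exact Continuous.measurable (by fun_prop)
  rw [show polarCoord.target = Ioi (0 : ℝ) ×ˢ Ioo (-Real.pi) Real.pi from rfl]
  have hkey : ∫⁻ p in Ioi (0 : ℝ) ×ˢ Ioo (-Real.pi) Real.pi, ENNReal.ofReal p.1 *
      (Metric.ball (0 : ℂ) 1).indicator (fun w => ‖g (z + w)‖ₑ) (Complex.polarCoord.symm p) =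
      ∫⁻ r in Ioi (0 : ℝ), ∫⁻ θ in Ioo (-Real.pi) Real.pi, ENNReal.ofReal r *
      (Metric.ball (0 : ℂ) 1).indicator (fun w => ‖g (z + w)‖ₑ)
        (Complex.polarCoord.symm (r, θ)) := by
    rw [Measure.volume_eq_prod, ← Measure.prod_restrict, lintegral_prod _ hmeas2.aemeasurable]
  simp only [smul_eq_mul] at *
  rw [hkey]
  calc ENNReal.ofReal Real.pi * ‖g z‖ₑ
      = ∫⁻ r in Ioo (0 : ℝ) 1,
          ENNReal.ofReal r * (ENNReal.ofReal (2 * Real.pi) * ‖g z‖ₑ) := by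
        rw [lintegral_mul_const _ (by fun_prop)]
        rw [← ofReal_integral_eq_lintegral_ofReal, ← integral_Ioc_eq_integral_Ioo,
          ← intervalIntegral.integral_of_le zero_le_one, integral_id, ← mul_assoc,
          ← ENNReal.ofReal_mul (by norm_num)]
        · congr 2; ring
        · exact (continuous_id.integrableOn_Icc (a := (0 : ℝ)) (b := 1)).mono_set Ioo_subset_Icc_self
        · exact (ae_restrict_mem measurableSet_Ioo).mono fun r hr => hr.1.le
    _ ≤ ∫⁻ r in Ioo (0 : ℝ) 1, ∫⁻ θ in Ioo (-Real.pi) Real.pi, ENNReal.ofReal r *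
      (Metric.ball (0 : ℂ) 1).indicator (fun w => ‖g (z + w)‖ₑ)
        (Complex.polarCoord.symm (r, θ)) := by
        refine setLIntegral_mono' measurableSet_Ioo fun r hr => ?_
        rw [lintegral_const_mul' _ _ ENNReal.ofReal_ne_top]
        gcongr
        refine (hcirc r).trans (lintegral_mono fun θ => ?_)
        have hmem : Complex.polarCoord.symm (r, θ) ∈ Metric.ball (0 : ℂ) 1 := by
          rw [mem_ball_zero_iff, Complex.norm_polarCoord_symm, abs_of_pos hr.1]
          exact hr.2
        rw [indicator_of_mem hmem, Complex.polarCoord_symm_apply, circleMap, Complex.exp_mul_I]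
        simp
    _ ≤ _ := lintegral_mono_set Ioo_subset_Ioi_self

lemma entire_bound (R : ℝ) : ∃ C : ℝ, ∀ u : Lp ℂ 2 fockMeasure, ∀ g : ℂ → ℂ,
    Differentiable ℂ g → u =ᵐ[fockMeasure] g → ∀ z : ℂ, ‖z‖ < R → ‖g z‖ ^ 2 ≤ C * ‖u‖ ^ 2 := by
  refine ⟨Real.exp ((R + 1) ^ 2) / Real.pi, fun u g hg hug z hz => ?_⟩
  have hcont : Continuous g := hg.continuous
  have h1 := pi_mul_enorm_le (hg.pow 2) z
  have hwm : Measurable fun z : ℂ => ENNReal.ofReal (Real.exp (-‖z‖ ^ 2)) := by fun_prop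
  have h2 : ∫⁻ w in Metric.ball z 1, ‖(g ^ 2) w‖ₑ ≤
      ENNReal.ofReal (Real.exp ((R + 1) ^ 2)) * ∫⁻ w, ‖g w‖ₑ ^ (2 : ℝ) ∂fockMeasure := by
    rw [fockMeasure, lintegral_withDensity_eq_lintegral_mul _ hwm (by fun_prop),
      ← lintegral_const_mul' _ _ ENNReal.ofReal_ne_top]
    refine (setLIntegral_mono' measurableSet_ball fun w hw => ?_).trans
      (setLIntegral_le_lintegral (Metric.ball z 1) _)
    simp only [Pi.mul_apply, Pi.pow_apply]
    rw [← mul_assoc, ← ENNReal.ofReal_mul (Real.exp_pos _).le, ← Real.exp_add, enorm_pow,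
      ENNReal.rpow_ofNat]
    refine le_mul_of_one_le_left zero_le ?_
    rw [← ENNReal.ofReal_one]
    refine ENNReal.ofReal_le_ofReal (Real.one_le_exp ?_)
    have hw' : ‖w‖ ≤ R + 1 := by
      have h5 : ‖w‖ ≤ ‖w - z‖ + ‖z‖ := by simpa using norm_add_le (w - z) z
      have h6 : ‖w - z‖ < 1 := by simpa [dist_eq_norm] using hw
      linarith
    nlinarith [norm_nonneg w]
  have h3 : ∫⁻ w, ‖g w‖ₑ ^ (2 : ℝ) ∂fockMeasure = ENNReal.ofReal (‖u‖ ^ 2) := by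
    have h4 : ∫⁻ w, ‖g w‖ₑ ^ (2 : ℝ) ∂fockMeasure = ∫⁻ w, ‖u w‖ₑ ^ (2 : ℝ) ∂fockMeasure :=
      lintegral_congr_ae (hug.mono fun w hw => by simp only [hw])
    have h5 := eLpNorm_eq_lintegral_rpow_enorm_toReal (f := u) (μ := fockMeasure) (p := 2)
      (by norm_num) (by norm_num)
    rw [h4, ENNReal.ofReal_pow (norm_nonneg _), Lp.norm_def,
      ENNReal.ofReal_toReal (Lp.memLp u).2.ne, h5, ← ENNReal.rpow_ofNat, ← ENNReal.rpow_mul]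
    simp
  rw [h3, ← ENNReal.ofReal_mul (Real.exp_pos _).le] at h2
  have h4 := h1.trans h2
  rw [Pi.pow_apply, enorm_pow, ← ofReal_norm, ← ENNReal.ofReal_pow (norm_nonneg _),
    ← ENNReal.ofReal_mul Real.pi_pos.le, ENNReal.ofReal_le_ofReal_iff (by positivity)] at h4
  rw [div_mul_eq_mul_div, le_div_iff₀ Real.pi_pos]
  linarith

lemma isClosed_fockSpace : IsClosed (fockSpace : Set (Lp ℂ 2 fockMeasure)) := by
  refine IsSeqClosed.isClosed fun u v hu huv => ?_
  choose g hg hug using hu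
  have hdiff : ∀ n m, (u n - u m : Lp ℂ 2 fockMeasure) =ᵐ[fockMeasure] (g n - g m) := fun n m =>
    (Lp.coeFn_sub _ _).trans ((hug n).sub (hug m))
  have hC : ∀ R : ℝ, UniformCauchySeqOn g atTop (Metric.ball 0 R) := by
    intro R
    obtain ⟨C, hC⟩ := entire_bound R
    rw [Metric.uniformCauchySeqOn_iff]
    intro ε hε
    obtain ⟨N, hN⟩ := (Metric.cauchySeq_iff.1 huv.cauchySeq) (ε / (|C| + 1)) (by positivity)
    refine ⟨N, fun m hm n hn z hz => ?_⟩
    have h1 := hC _ _ ((hg m).sub (hg n)) (hdiff m n) z (by simpa using hz)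
    have h2 : ‖u m - u n‖ < ε / (|C| + 1) := by simpa [dist_eq_norm] using hN m hm n hn
    rw [dist_eq_norm]
    rw [lt_div_iff₀ (by positivity)] at h2
    have h3 : ‖g m z - g n z‖ ^ 2 ≤ C * ‖u m - u n‖ ^ 2 := h1
    refine lt_of_pow_lt_pow_left₀ 2 hε.le (h3.trans_lt ?_)
    calc C * ‖u m - u n‖ ^ 2 ≤ (|C| + 1) ^ 2 * ‖u m - u n‖ ^ 2 := by
          gcongr
          nlinarith [le_abs_self C, abs_nonneg C]
      _ = (‖u m - u n‖ * (|C| + 1)) ^ 2 := by ring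
      _ < ε ^ 2 := by gcongr
  have hpt : ∀ z, ∃ y, Tendsto (fun n => g n z) atTop (𝓝 y) := fun z =>
    cauchySeq_tendsto_of_complete ((hC (‖z‖ + 1)).cauchySeq (by simp))
  choose G hG using hpt
  have hlu : TendstoLocallyUniformlyOn g G atTop univ := by
    rw [tendstoLocallyUniformlyOn_iff_forall_isCompact isOpen_univ]
    intro K _ hK
    obtain ⟨R, hR⟩ := hK.isBounded.subset_ball 0
    exact ((hC R).tendstoUniformlyOn_of_tendsto fun z _ => hG z).mono hR
  have hGd : Differentiable ℂ G := by
    rw [← differentiableOn_univ]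
    exact hlu.differentiableOn (Eventually.of_forall fun n => (hg n).differentiableOn) isOpen_univ
  refine ⟨G, hGd, ?_⟩
  obtain ⟨ns, hns, hae⟩ := (tendstoInMeasure_of_tendsto_Lp huv).exists_seq_tendsto_ae
  filter_upwards [hae, ae_all_iff.2 hug] with z h1 h2
  refine tendsto_nhds_unique h1 ?_
  simp only [h2]
  exact (hG z).comp hns.tendsto_atTop

instance : CompleteSpace fockSpace := isClosed_fockSpace.completeSpace_coe

/-- The Bargmann-Toeplitz operator `T_V f = P (V f)` on the Fock space, where `P` is the orthogonal
projection of `L²(ℂ, e^{-|z|²} dm(z))` onto the Fock space and `V` is a bounded real symbol. -/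
def toeplitz (V : ℂ → ℝ) (hV : MemLp (fun z => (V z : ℂ)) ∞ fockMeasure) :
    fockSpace →L[ℂ] fockSpace :=
  fockSpace.orthogonalProjectionOnto ∘L
    ((ContinuousLinearMap.mul ℂ ℂ).holderL fockMeasure ∞ 2 2 hV.toLp) ∘L fockSpace.subtypeL

/-- Continuous compactly supported symbols are bounded. -/
lemma memLp_symbol {V : ℂ → ℝ} (hc : Continuous V) (hs : HasCompactSupport V) :
    MemLp (fun z => (V z : ℂ)) ∞ fockMeasure := by
  obtain ⟨C, hC⟩ := hs.exists_bound_of_continuous hc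
  refine memLp_top_of_bound (by fun_prop) C (Eventually.of_forall fun z => ?_)
  simpa using hC z

/-- The negative part `V₋ = (|V| - V) / 2`. -/
def negPart (V : ℂ → ℝ) : ℂ → ℝ := fun z => (|V z| - V z) / 2

/-- `Γ` is a smooth simple closed curve: the image of a regular closed parametrization of class
`C¹` that is injective on a period. -/
def IsSmoothSimpleClosedCurve (Γ : Set ℂ) : Prop :=
  ∃ γ : ℝ → ℂ, ContDiff ℝ 1 γ ∧ (∀ t, deriv γ t ≠ 0) ∧ Function.Periodic γ 1 ∧
    InjOn γ (Ico 0 1) ∧ range γ = Γ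

/-- The points lying inside the closed curve `Γ`: those in the bounded components of the
complement of `Γ`. -/
def inside (Γ : Set ℂ) : Set ℂ :=
  {z | z ∉ Γ ∧ Bornology.IsBounded (connectedComponentIn Γᶜ z)}

end BargmannToeplitz

end

noncomputable section

open MeasureTheory Set Filter Topology
open scoped ENNReal

namespace BargmannToeplitz

/-! ### Symmetric operators that are nonnegative on a subspace of finite codimension -/

section Symmetric

variable {E W : Type*} [NormedAddCommGroup E] [InnerProductSpace ℂ E]
  [AddCommGroup W] [Module ℂ W] [FiniteDimensional ℂ W]

/-! It is enough to find finitely many points such that the form `∫ V |g|² e^{-|z|²}` is nonnegative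
on every Fock function `g` vanishing there. Evaluation at these points is then a linear map to a
finite-dimensional space whose kernel carries a nonnegative form, so the negative eigenspaces are
finite-dimensional and finite in number.

Let `M = max_Γ |g|`, attained at `z₀`. By the maximum principle `|g| ≤ M` inside `Γ`. If the zeros
of `g` form a fine enough net in `K = supp V₋`, the Schwarz lemma improves this to `|g| ≤ ε M` on
`K` (`exists_finset_forall_norm_le`), so the negative contribution is `O(ε² M²)`. Near `z₀` one has
`V ≥ δ/2`, and the mean value inequality for `g²` gives a positive contribution of at least `a M²`,
with `a` independent of `g`. A small `ε` makes the sum nonnegative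
(`exists_finset_integral_nonneg`). -/

lemma finiteDimensional_eigenspace_of_nonneg_on_ker {T : E →ₗ[ℂ] E} (e : E →ₗ[ℂ] W)
    (hpos : ∀ x, e x = 0 → 0 ≤ (inner ℂ x (T x)).re) {lam : ℝ} (hlam : lam < 0) :
    FiniteDimensional ℂ (Module.End.eigenspace T (lam : ℂ)) := by
  -- `e` is injective on the eigenspace: an `x` in its kernel satisfies `0 ≤ lam * ‖x‖ ^ 2` with
  -- `lam < 0`.
  refine FiniteDimensional.of_injective (e.domRestrict _) ?_
  rw [← LinearMap.ker_eq_bot, LinearMap.ker_eq_bot']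
  rintro ⟨x, hx⟩ hex
  have h := hpos x hex
  rw [Module.End.mem_eigenspace_iff.1 hx, inner_smul_right, inner_self_eq_norm_sq_to_K] at h
  norm_cast at h
  by_contra hne
  have hx0 : 0 < ‖x‖ := norm_pos_iff.2 fun h0 => hne (Subtype.ext h0)
  have : 0 ≤ lam * ‖x‖ ^ 2 := by
    simpa [← Complex.ofReal_pow, -Complex.ofReal_pow] using h
  nlinarith [sq_pos_of_pos hx0]

/-- Eigenvectors for distinct negative eigenvalues have linearly independent images under `e`. By
orthogonality the form at `∑ c j • v j` is `∑ j ‖c j‖² ‖v j‖²`, where the index `j` is itself the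
eigenvalue; if the combination lies in the kernel, this sum of nonpositive terms is nonnegative,
which forces every `c j = 0`. -/
lemma finite_negative_eigenvalues_of_nonneg_on_ker {T : E →ₗ[ℂ] E} (hT : T.IsSymmetric)
    (e : E →ₗ[ℂ] W) (hpos : ∀ x, e x = 0 → 0 ≤ (inner ℂ x (T x)).re) :
    {lam : ℝ | lam < 0 ∧ Module.End.HasEigenvalue T (lam : ℂ)}.Finite := by
  set S := {lam : ℝ | lam < 0 ∧ Module.End.HasEigenvalue T (lam : ℂ)}
  choose v hv using fun s : S => s.2.2.exists_hasEigenvector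
  have horth : ∀ i j : S, i ≠ j → inner ℂ (v i) (v j) = 0 := fun i j hij =>
    hT.orthogonalFamily_eigenspaces (i := ((i : ℝ) : ℂ)) (j := ((j : ℝ) : ℂ))
      (by simpa [Subtype.ext_iff] using hij) ⟨v i, (hv i).1⟩ ⟨v j, (hv j).1⟩
  have hli : LinearIndependent ℂ (fun s : S => e (v s)) := by
    rw [linearIndependent_iff']
    intro t c hc i hi
    have hker : e (∑ j ∈ t, c j • v j) = 0 := by simpa using hc
    have h := hpos _ hker
    have hT' : T (∑ j ∈ t, c j • v j) = ∑ j ∈ t, c j • ((j : ℝ) : ℂ) • v j := by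
      simp only [map_sum, map_smul]
      exact Finset.sum_congr rfl fun j _ => by rw [(hv j).apply_eq_smul]
    have hsum : (inner ℂ (∑ j ∈ t, c j • v j) (T (∑ j ∈ t, c j • v j))).re =
        ∑ j ∈ t, (j : ℝ) * (‖c j‖ ^ 2 * ‖v j‖ ^ 2) := by
      rw [hT', sum_inner, Complex.re_sum]
      refine Finset.sum_congr rfl fun j hj => ?_
      rw [inner_sum, Finset.sum_eq_single j]
      · rw [inner_smul_left, inner_smul_right, inner_smul_right, inner_self_eq_norm_sq_to_K]
        have : (starRingEnd ℂ) (c j) * (c j * ((j : ℝ) * ((‖v j‖ : ℂ)) ^ 2)) =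
            (((j : ℝ) * (‖c j‖ ^ 2 * ‖v j‖ ^ 2) : ℝ) : ℂ) := by
          push_cast
          rw [← Complex.conj_mul']
          ring
        exact (congrArg Complex.re this).trans (Complex.ofReal_re _)
      · intro k _ hk
        rw [inner_smul_left, inner_smul_right, inner_smul_right, horth j k hk.symm]
        simp
      · exact fun hj' => absurd hj hj'
    rw [hsum] at h
    have hle : ∀ j ∈ t, (j : ℝ) * (‖c j‖ ^ 2 * ‖v j‖ ^ 2) ≤ 0 := fun j _ =>
      mul_nonpos_of_nonpos_of_nonneg j.2.1.le (by positivity)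
    have h0 := (Finset.sum_eq_zero_iff_of_nonpos hle).1 (le_antisymm (Finset.sum_nonpos hle) h) i hi
    simpa [i.2.1.ne, (hv i).2] using h0
  have := hli.finite
  exact Set.toFinite S

end Symmetric

/-! ### Estimates for entire functions -/

/-- The case of the unit disc, rescaled by `w ↦ z + r * w`. -/
lemma pi_mul_sq_mul_norm_le {g : ℂ → ℂ} (hg : Differentiable ℂ g) (z : ℂ) {r : ℝ} (hr : 0 < r) :
    Real.pi * r ^ 2 * ‖g z‖ ≤ ∫ w in Metric.ball z r, ‖g w‖ := by
  have hc : Continuous g := hg.continuous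
  have h1 := pi_mul_enorm_le (g := fun w => g (z + r * w)) (by fun_prop) 0
  have hint : Integrable (fun w : ℂ => g (z + r * w)) (volume.restrict (Metric.ball 0 1)) :=
    ((show Continuous fun w : ℂ => g (z + r * w) by fun_prop).continuousOn.integrableOn_compact
      (isCompact_closedBall 0 1)).mono_set Metric.ball_subset_closedBall
  rw [← ofReal_integral_norm_eq_lintegral_enorm hint, mul_zero, add_zero, ← ofReal_norm,
    ← ENNReal.ofReal_mul Real.pi_pos.le,
    ENNReal.ofReal_le_ofReal_iff (integral_nonneg fun _ => norm_nonneg _)] at h1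
  have h2 := Measure.setIntegral_comp_smul (volume : Measure ℂ) (fun w => ‖g (z + w)‖)
    (Metric.ball 0 1) hr.ne'
  rw [smul_unitBall_of_pos hr, Complex.finrank_real_complex] at h2
  simp only [Complex.real_smul] at h2
  rw [h2] at h1
  have h3 : ∫ w in Metric.ball (0 : ℂ) r, ‖g (z + w)‖ = ∫ w in Metric.ball z r, ‖g w‖ := by
    have h4 := (measurePreserving_add_left (volume : Measure ℂ) z).setIntegral_preimage_emb
      (measurableEmbedding_addLeft z) (fun w => ‖g w‖) (Metric.ball z r)
    rwa [preimage_add_ball, sub_self] at h4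
  rw [h3, abs_of_pos (by positivity), smul_eq_mul, inv_mul_eq_div, le_div_iff₀ (by positivity)] at h1
  linarith

/-- A frontier point off `Γ` would have an open component of its own meeting that of `z`; the two
would coincide, but an open set contains none of its frontier. -/
lemma frontier_connectedComponentIn_compl_subset {Γ : Set ℂ} (hΓ : IsClosed Γ) (z : ℂ) :
    frontier (connectedComponentIn Γᶜ z) ⊆ Γ := by
  intro w hw
  by_contra hwΓ
  have hopen : ∀ x, IsOpen (connectedComponentIn Γᶜ x) := fun x =>
    hΓ.isOpen_compl.connectedComponentIn
  rw [(hopen z).frontier_eq] at hw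
  obtain ⟨y, hyw, hyz⟩ := mem_closure_iff.1 hw.1 _ (hopen w) (mem_connectedComponentIn hwΓ)
  have h1 := connectedComponentIn_eq hyw
  have h2 := connectedComponentIn_eq hyz
  exact hw.2 (h2 ▸ h1 ▸ mem_connectedComponentIn hwΓ)

lemma isOpen_inside {Γ : Set ℂ} (hΓ : IsClosed Γ) : IsOpen (inside Γ) := by
  rw [isOpen_iff_mem_nhds]
  rintro z ⟨hz, hb⟩
  filter_upwards [hΓ.isOpen_compl.connectedComponentIn.mem_nhds (mem_connectedComponentIn hz)]
    with w hw
  exact ⟨connectedComponentIn_subset _ _ hw, connectedComponentIn_eq hw ▸ hb⟩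

/-- Maximum principle on the bounded component of `z`. Working by component avoids the Jordan curve
theorem. -/
lemma norm_le_of_mem_inside {Γ : Set ℂ} (hΓ : IsClosed Γ) {g : ℂ → ℂ} (hg : Differentiable ℂ g)
    {M : ℝ} (hM : ∀ w ∈ Γ, ‖g w‖ ≤ M) {z : ℂ} (hz : z ∈ inside Γ) : ‖g z‖ ≤ M :=
  Complex.norm_le_of_forall_mem_frontier_norm_le hz.2 hg.diffContOnCl
    (fun w hw => hM w (frontier_connectedComponentIn_compl_subset hΓ z hw))
    (subset_closure (mem_connectedComponentIn hz.1))

/-- An entire function that vanishes at finitely many suitable points is small, compared with its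
values on `Γ`, on a given compact set inside `Γ`. -/
lemma exists_finset_forall_norm_le {Γ K : Set ℂ} (hΓ : IsClosed Γ) (hK : IsCompact K)
    (hKΓ : K ⊆ inside Γ) {ε : ℝ} (hε : 0 < ε) :
    ∃ F : Finset ℂ, ∀ g : ℂ → ℂ, Differentiable ℂ g → (∀ z ∈ F, g z = 0) →
      ∀ M : ℝ, (∀ w ∈ Γ, ‖g w‖ ≤ M) → ∀ z ∈ K, ‖g z‖ ≤ ε * M := by
  obtain ⟨R, hR, hRsub⟩ := hK.exists_thickening_subset_open (isOpen_inside hΓ) hKΓ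
  -- Radius `R` keeps the point in the disc where the Schwarz lemma applies; `ε * R` makes its
  -- factor `dist z c / R` at most `ε`.
  obtain ⟨F, hFK, hF⟩ := hK.elim_nhds_subcover (fun z => Metric.ball z (min R (ε * R)))
    fun z _ => Metric.ball_mem_nhds z (by positivity)
  refine ⟨F, fun g hg hgF M hM z hz => ?_⟩
  obtain ⟨c, hc, hzc⟩ := mem_iUnion₂.1 (hF hz)
  have hball : Metric.ball c R ⊆ inside Γ := (Metric.ball_subset_thickening (hFK c hc) R).trans hRsub
  rw [Metric.mem_ball, lt_min_iff] at hzc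
  have hmaps : MapsTo g (Metric.ball c R) (Metric.closedBall (g c) M) := fun w hw => by
    simpa [hgF c hc] using norm_le_of_mem_inside hΓ hg hM (hball hw)
  have hM0 : 0 ≤ M := (norm_nonneg _).trans (norm_le_of_mem_inside hΓ hg hM (hKΓ hz))
  have h := Complex.dist_le_div_mul_dist_of_mapsTo_ball hg.differentiableOn hmaps hzc.1
  rw [hgF c hc, dist_zero_right] at h
  calc ‖g z‖ ≤ M / R * dist z c := h
    _ ≤ M / R * (ε * R) := by gcongr; exact hzc.2.le
    _ = ε * M := by field_simp

/-! ### Nonnegativity of the form on functions with prescribed zeros -/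

lemma IsSmoothSimpleClosedCurve.isCompact {Γ : Set ℂ} (h : IsSmoothSimpleClosedCurve Γ) :
    IsCompact Γ := by
  obtain ⟨γ, hγ, -, hper, -, rfl⟩ := h
  rw [← hper.image_uIcc one_ne_zero 0]
  exact isCompact_uIcc.image hγ.continuous

lemma IsSmoothSimpleClosedCurve.nonempty {Γ : Set ℂ} (h : IsSmoothSimpleClosedCurve Γ) :
    Γ.Nonempty := by
  obtain ⟨γ, -, -, -, -, rfl⟩ := h
  exact range_nonempty γ

lemma exists_thickening_half_le {V : ℂ → ℝ} (hV : Continuous V) {Γ : Set ℂ} (hΓ : IsCompact Γ)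
    {δ : ℝ} (hδ : 0 < δ) (hVΓ : ∀ z ∈ Γ, δ ≤ V z) :
    ∃ r > 0, ∀ z ∈ Γ, ∀ w ∈ Metric.ball z r, δ / 2 ≤ V w := by
  obtain ⟨r, hr, hsub⟩ := hΓ.exists_thickening_subset_open (isOpen_Ioi.preimage hV : IsOpen
    (V ⁻¹' Ioi (δ / 2))) fun z hz => show δ / 2 < V z by linarith [hVΓ z hz]
  exact ⟨r, hr, fun z hz w hw => (hsub (Metric.ball_subset_thickening hz r hw)).le⟩

lemma nonneg_of_notMem_tsupport_negPart {V : ℂ → ℝ} {z : ℂ} (hz : z ∉ tsupport (negPart V)) :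
    0 ≤ V z := by
  have h : (|V z| - V z) / 2 = 0 :=
    image_eq_zero_of_notMem_tsupport (f := negPart V) hz
  linarith [abs_nonneg (V z)]

lemma integral_fockMeasure (h : ℂ → ℝ) :
    ∫ z, h z ∂fockMeasure = ∫ z : ℂ, Real.exp (-‖z‖ ^ 2) * h z := by
  have hm : Measurable fun z : ℂ => Real.toNNReal (Real.exp (-‖z‖ ^ 2)) := by fun_prop
  have := integral_withDensity_eq_integral_smul (μ := (volume : Measure ℂ)) hm h
  simp only [NNReal.smul_def, Real.coe_toNNReal _ (Real.exp_pos _).le, smul_eq_mul] at this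
  exact this

lemma exists_finset_integral_nonneg {V : ℂ → ℝ} (hVc : Continuous V) (hVs : HasCompactSupport V)
    {Γ : Set ℂ} (hΓ : IsCompact Γ) (hΓne : Γ.Nonempty) {δ : ℝ} (hδ : 0 < δ)
    (hVΓ : ∀ z ∈ Γ, δ ≤ V z) (hin : tsupport (negPart V) ⊆ inside Γ) :
    ∃ F : Finset ℂ, ∀ g : ℂ → ℂ, Differentiable ℂ g → (∀ z ∈ F, g z = 0) →
      0 ≤ ∫ z, V z * ‖g z‖ ^ 2 ∂fockMeasure := by
  obtain ⟨r, hr, hVr⟩ := exists_thickening_half_le hVc hΓ hδ hVΓ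
  obtain ⟨R, hR⟩ := hΓ.isBounded.exists_norm_le
  obtain ⟨C, hC⟩ := hVs.exists_bound_of_continuous hVc
  have hC0 : 0 ≤ C := (norm_nonneg _).trans (hC 0)
  set K := tsupport (negPart V) with hKdef
  have hK : IsCompact K := by
    refine hVs.of_isClosed_subset (isClosed_tsupport _) (closure_mono fun z hz => ?_)
    contrapose! hz
    simp_all [negPart]
  -- `a * M ^ 2` bounds below the contribution of the disc of radius `r` about the maximum point: `V
  -- ≥ δ / 2` there, and the weight is at least `exp (-(R + r) ^ 2)`.
  set a := δ / 2 * (Real.exp (-(R + r) ^ 2) * (Real.pi * r ^ 2)) with ha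
  have hapos : 0 < a := by positivity
  set b := C * volume.real K with hb
  have hb0 : 0 ≤ b := by positivity
  -- With `ε² = a / (b + 1)` the loss on `K` is at most `b / (b + 1) * (a * M ^ 2) ≤ a * M ^ 2`; the
  -- `+ 1` covers `b = 0`.
  obtain ⟨F, hF⟩ := exists_finset_forall_norm_le hΓ.isClosed hK hin
    (ε := Real.sqrt (a / (b + 1))) (by positivity)
  refine ⟨F, fun g hg hgF => ?_⟩
  have hgc : Continuous g := hg.continuous
  obtain ⟨z₀, hz₀, hmax⟩ := hΓ.exists_isMaxOn hΓne hgc.norm.continuousOn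
  set M := ‖g z₀‖
  have hgK : ∀ z ∈ K, ‖g z‖ ^ 2 ≤ a / (b + 1) * M ^ 2 := fun z hz => by
    rw [← Real.sq_sqrt (show 0 ≤ a / (b + 1) by positivity), ← mul_pow]
    exact pow_le_pow_left₀ (norm_nonneg _) (hF g hg hgF M (fun w hw => hmax hw) z hz) 2
  rw [integral_fockMeasure]
  have hexp : Continuous fun z : ℂ => Real.exp (-‖z‖ ^ 2) := by fun_prop
  have hi1 : Integrable (fun z : ℂ => Real.exp (-‖z‖ ^ 2) * (V z * ‖g z‖ ^ 2)) :=
    Continuous.integrable_of_hasCompactSupport (by fun_prop) (hVs.mul_right.mul_left)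
  have hball : IntegrableOn (fun w : ℂ => ‖g w‖ ^ 2) (Metric.ball z₀ r) :=
    ((hgc.norm.pow 2).continuousOn.integrableOn_compact (isCompact_closedBall z₀ r)).mono_set
      Metric.ball_subset_closedBall
  have hi2 : Integrable ((Metric.ball z₀ r).indicator
      fun w : ℂ => δ / 2 * (Real.exp (-(R + r) ^ 2) * ‖g w‖ ^ 2)) :=
    by
    refine IntegrableOn.integrable_indicator ?_ measurableSet_ball
    exact (hball.const_mul (Real.exp (-(R + r) ^ 2))).const_mul (δ / 2)
  have hi3 : Integrable (K.indicator fun _ : ℂ => C * (a / (b + 1) * M ^ 2)) :=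
    (integrableOn_const hK.measure_lt_top.ne).integrable_indicator hK.measurableSet
  -- Pointwise minorant: the gain on the disc minus the loss on `K`. Disjointness of the two sets is
  -- not needed, since subtracting the loss on the disc only lowers the bound; off both sets `V ≥
  -- 0`.
  have hle := integral_mono (hi2.sub hi3) hi1 fun z => by
    have hexp1 : Real.exp (-‖z‖ ^ 2) ≤ 1 := Real.exp_le_one_iff.2 (by nlinarith [norm_nonneg z])
    have hexp0 := Real.exp_pos (-‖z‖ ^ 2)
    simp only [Pi.sub_apply]
    have hind3 : 0 ≤ K.indicator (fun _ : ℂ => C * (a / (b + 1) * M ^ 2)) z :=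
      indicator_nonneg (fun _ _ => by positivity) z
    by_cases hzB : z ∈ Metric.ball z₀ r
    · rw [indicator_of_mem hzB]
      have hz : ‖z‖ ≤ R + r := by
        have h1 : ‖z‖ ≤ ‖z₀‖ + ‖z - z₀‖ := by simpa using norm_add_le z₀ (z - z₀)
        have h2 : ‖z - z₀‖ < r := by simpa [dist_eq_norm] using hzB
        linarith [hR z₀ hz₀]
      have h3 : Real.exp (-(R + r) ^ 2) ≤ Real.exp (-‖z‖ ^ 2) := by
        refine Real.exp_le_exp.2 ?_
        nlinarith [norm_nonneg z]
      have h4 := hVr z₀ hz₀ z hzB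
      have h5 : δ / 2 * (Real.exp (-(R + r) ^ 2) * ‖g z‖ ^ 2) ≤
          V z * (Real.exp (-‖z‖ ^ 2) * ‖g z‖ ^ 2) := by
        gcongr
        linarith
      linarith
    · rw [indicator_of_notMem hzB]
      by_cases hzK : z ∈ K
      · rw [indicator_of_mem hzK]
        have h1 := hgK z hzK
        have h2 : -C ≤ V z := (abs_le.1 (hC z)).1
        have h3 : Real.exp (-‖z‖ ^ 2) * (C * ‖g z‖ ^ 2) ≤ 1 * (C * (a / (b + 1) * M ^ 2)) := by
          gcongr
        have h4 : Real.exp (-‖z‖ ^ 2) * (-C * ‖g z‖ ^ 2) ≤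
            Real.exp (-‖z‖ ^ 2) * (V z * ‖g z‖ ^ 2) := by gcongr
        linarith
      · rw [indicator_of_notMem hzK]
        have := nonneg_of_notMem_tsupport_negPart hzK
        simp only [sub_zero]
        positivity
  rw [integral_sub' hi2 hi3, integral_indicator measurableSet_ball, integral_indicator
    hK.measurableSet, integral_const_mul, integral_const_mul, setIntegral_const] at hle
  -- Applied to the entire function `g ^ 2`, this is the mean value inequality for `‖g‖ ^ 2`.
  have hmean := pi_mul_sq_mul_norm_le (hg.pow 2) z₀ hr
  simp only [Pi.pow_apply, norm_pow] at hmean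
  refine le_trans ?_ hle
  have h1 : a * M ^ 2 ≤ δ / 2 * (Real.exp (-(R + r) ^ 2) *
      ∫ w in Metric.ball z₀ r, ‖g w‖ ^ 2) := by
    rw [ha, mul_assoc, mul_assoc]
    gcongr
  have h2 : volume.real K • (C * (a / (b + 1) * M ^ 2)) = b / (b + 1) * (a * M ^ 2) := by
    rw [hb, smul_eq_mul]; ring
  have h3 : b / (b + 1) * (a * M ^ 2) ≤ 1 * (a * M ^ 2) := by
    gcongr
    rw [div_le_one (by positivity)]
    linarith
  rw [h2]
  linarith

/-! ### Point evaluations and the quadratic form -/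

/-- The Gaussian weight never vanishes. This direction makes the continuous representative of a
class unique. -/
lemma volume_absolutelyContinuous_fockMeasure : (volume : Measure ℂ) ≪ fockMeasure :=
  withDensity_absolutelyContinuous' (by fun_prop) (Eventually.of_forall fun z => by
    simpa using Real.exp_pos _)

lemma eq_of_ae_eq_fockMeasure {g h : ℂ → ℂ} (hg : Continuous g) (hh : Continuous h)
    (hgh : g =ᵐ[fockMeasure] h) : g = h :=
  Measure.eq_of_ae_eq (volume_absolutelyContinuous_fockMeasure.ae_eq hgh) hg hh

/-- The entire representative of an element of the Fock space. -/
def entireRep (f : fockSpace) : ℂ → ℂ := f.2.choose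

lemma differentiable_entireRep (f : fockSpace) : Differentiable ℂ (entireRep f) :=
  f.2.choose_spec.1

lemma coe_ae_eq_entireRep (f : fockSpace) :
    (f : Lp ℂ 2 fockMeasure) =ᵐ[fockMeasure] entireRep f :=
  f.2.choose_spec.2

/-- Evaluation of the elements of the Fock space at the points of a finite set. -/
def evalOn (F : Finset ℂ) : fockSpace →ₗ[ℂ] (F → ℂ) where
  toFun f z := entireRep f z
  map_add' f g := by
    -- The representatives are arbitrary choices; uniqueness among continuous functions makes them
    -- depend linearly on the class.
    have h : entireRep (f + g) = entireRep f + entireRep g :=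
      eq_of_ae_eq_fockMeasure (differentiable_entireRep _).continuous
        ((differentiable_entireRep f).add (differentiable_entireRep g)).continuous
        ((coe_ae_eq_entireRep (f + g)).symm.trans ((Lp.coeFn_add _ _).trans
          ((coe_ae_eq_entireRep f).add (coe_ae_eq_entireRep g))))
    funext z
    rw [h]
    rfl
  map_smul' c f := by
    have h : entireRep (c • f) = c • entireRep f :=
      eq_of_ae_eq_fockMeasure (differentiable_entireRep _).continuous
        ((differentiable_entireRep f).const_smul c).continuous
        ((coe_ae_eq_entireRep (c • f)).symm.trans ((Lp.coeFn_smul _ _).trans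
          ((coe_ae_eq_entireRep f).const_smul c)))
    funext z
    rw [h]
    rfl

/-- The projection disappears because `f` already lies in the Fock space: `⟨f, P(Vg)⟩ = ⟨f, Vg⟩`. -/
lemma inner_toeplitz (V : ℂ → ℝ) (hV : MemLp (fun z => (V z : ℂ)) ∞ fockMeasure)
    (f g : fockSpace) : inner ℂ f (toeplitz V hV g) =
      ∫ z, (V z : ℂ) * inner ℂ (entireRep f z) (entireRep g z) ∂fockMeasure := by
  rw [toeplitz, ContinuousLinearMap.comp_apply,
    Submodule.inner_orthogonalProjectionOnto_eq_of_mem_left, L2.inner_def]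
  refine integral_congr_ae ?_
  simp only [ContinuousLinearMap.comp_apply, ContinuousLinearMap.holderL_apply_apply]
  filter_upwards [ContinuousLinearMap.coeFn_holder (r := 2) (ContinuousLinearMap.mul ℂ ℂ)
    hV.toLp (g : Lp ℂ 2 fockMeasure), hV.coeFn_toLp, coe_ae_eq_entireRep f,
    coe_ae_eq_entireRep g] with z h1 h2 h3 h4
  have h1' := h1
  rw [Submodule.subtypeL_apply, h1', ContinuousLinearMap.mul_apply', h2, h3, h4, ← smul_eq_mul,
    inner_smul_right]

lemma isSymmetric_toeplitz (V : ℂ → ℝ) (hV : MemLp (fun z => (V z : ℂ)) ∞ fockMeasure) :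
    (toeplitz V hV).toLinearMap.IsSymmetric := by
  intro f g
  simp only [ContinuousLinearMap.coe_coe]
  rw [← inner_conj_symm, inner_toeplitz, inner_toeplitz, ← integral_conj]
  refine integral_congr_ae (Eventually.of_forall fun z => ?_)
  simp only [map_mul, Complex.conj_ofReal, inner_conj_symm]

lemma re_inner_toeplitz_self (V : ℂ → ℝ) (hV : MemLp (fun z => (V z : ℂ)) ∞ fockMeasure)
    (f : fockSpace) : (inner ℂ f (toeplitz V hV f)).re =
      ∫ z, V z * ‖entireRep f z‖ ^ 2 ∂fockMeasure := by
  rw [inner_toeplitz, ← Complex.ofReal_re (∫ z, V z * ‖entireRep f z‖ ^ 2 ∂fockMeasure),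
    ← integral_complex_ofReal]
  congr 2
  funext z
  rw [inner_self_eq_norm_sq_to_K]
  push_cast
  rfl

end BargmannToeplitz

end
theorem theorem2 (V : ℂ → ℝ) (hVc : Continuous V) (hVs : HasCompactSupport V)
    (hK : IsConnected (tsupport V))
    (Γ : Set ℂ) (hΓ : BargmannToeplitz.IsSmoothSimpleClosedCurve Γ) (hΓK : Γ ⊆ tsupport V)
    (δ : ℝ) (hδ : 0 < δ) (hVΓ : ∀ z ∈ Γ, δ ≤ V z)
    (hin : tsupport (BargmannToeplitz.negPart V) ⊆ BargmannToeplitz.inside Γ) :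
    {lam : ℝ | lam < 0 ∧ Module.End.HasEigenvalue
      (BargmannToeplitz.toeplitz V (BargmannToeplitz.memLp_symbol hVc hVs)).toLinearMap
        (lam : ℂ)}.Finite ∧
    ∀ lam : ℝ, lam < 0 → FiniteDimensional ℂ (Module.End.eigenspace
      (BargmannToeplitz.toeplitz V (BargmannToeplitz.memLp_symbol hVc hVs)).toLinearMap
        (lam : ℂ)) := by

  obtain ⟨F, hF⟩ := BargmannToeplitz.exists_finset_integral_nonneg hVc hVs hΓ.isCompact
    hΓ.nonempty hδ hVΓ hin
  have hpos : ∀ f : BargmannToeplitz.fockSpace, BargmannToeplitz.evalOn F f = 0 →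
      0 ≤ (inner ℂ f ((BargmannToeplitz.toeplitz V
        (BargmannToeplitz.memLp_symbol hVc hVs)).toLinearMap f)).re := fun f hf => by
    rw [ContinuousLinearMap.coe_coe, BargmannToeplitz.re_inner_toeplitz_self]
    exact hF _ (BargmannToeplitz.differentiable_entireRep f) fun z hz => congrFun hf ⟨z, hz⟩
  exact ⟨BargmannToeplitz.finite_negative_eigenvalues_of_nonneg_on_ker
      (BargmannToeplitz.isSymmetric_toeplitz V _) _ hpos,
    fun lam hlam => BargmannToeplitz.finiteDimensional_eigenspace_of_nonneg_on_ker _ hpos hlam⟩
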